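/- Let $\mathcal X_k=\{x\in\mathbb R^k:\|x\|\le\frac12\}$ with the Euclidean metric $d$ and the uniform distribution $\mathcal U[\mathcal X_k]$, and let $\mathcal C_{\mathrm{HHS}}=\{\mathbb 1\{\langle\omega,x\rangle\ge 0\}\mid\omega\in\mathbb R^k\}$ be the class of homogeneous half-spaces over $\mathcal X_k$. For $\ell,C\subseteq\mathcal X_k$ (identified with their indicator functions) let $\mathrm{err}(C,\ell)=\Pr_{x\sim\mathcal U[\mathcal X_k]}[C(x)\ne\ell(x)]$. Let $f:\mathbb R^{\ge0}\to\mathbb R^{\ge0}$. For a labelling rule $\ell$ and $x\in\mathcal X_k$, let $\mathrm{CE}_{\min}(x)$ be the set of points nearest to $x$ among all limits of sequences of points of $\mathcal X_k$ labelled differently from $x$. An admissible family (probabilistic approximate minimum distance mechanism with noise function $f$) for $\ell$ is a measurable family of probability distributions $(\mathcal D_x)_{x\in\mathcal X_k}$ such that $\mathcal D_x$ is concentrated on points whose label differs from $\ell(x)$ and, for every $x$ at positive distance from the points labelled differently from $x$, there is $p\in\mathrm{CE}_{\min}(x)$ with $\mathbb E_{x'\sim\mathcal D_x}[d(x',p)]\le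 f(d(x,p))$. A passive learner maps, for every $m$, an unordered collection of $m$ labelled pairs $((x_i,\ell(x_i)),(x_i',\ell(x_i')))$ to a hypothesis in $\mathcal C_{\mathrm{HHS}}$; the $x_i$ are drawn i.i.d. from $\mathcal U[\mathcal X_k]$, and $x_i'$ is drawn independently from $\mathcal D_{x_i}$. For a passive learner $A$ and $\varepsilon\in(0,1]$, let $\mathcal M_{A}(\varepsilon)$ be the least $m^*\in\mathbb N$ such that for all $\ell\in\mathcal C_{\mathrm{HHS}}$, all $m\ge m^*$ and all admissible families for $\ell$, the expected error of the hypothesis output by $A$ on $m$ pairs is at most $\varepsilon$ ($\mathcal M_A(\varepsilon)=\infty$ if there is none). The passive expected contrastive sample complexity is $\mathcal M_{k,f}(\varepsilon)=\inf_A\mathcal M_A(\varepsilon)$, the infimum being over all passive learners $A$. Theorem. There is an absolute constant $K>0$ such that the following holds. Let $f:\mathbb R^{\ge0}\to\mathbb R^{\ge0}$ be such that $f(x)\le x^2$ for all $x$ and $g(x):=f(x)/x$ (with $g(0):=0$) is non-decreasing and invertible (injective, with inverse $g^{-1}$ defined on the range of $g$). Then there is $\varepsilon_0\in(0,1]$,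 depending only on $f$, such that for all $k$ and all $\varepsilon\in(0,\varepsilon_0)$ for which $\pi\varepsilon/2$ lies in the range of $g$ (that is, for all $\varepsilon\in(0,\varepsilon_0)$ if $g$ is onto $\mathbb R^{\ge0}$), \[ \mathcal M_{k,f}(\varepsilon)\;\le\;K\,\frac{\log(1/\varepsilon)}{g^{-1}(\pi\varepsilon/2)} . \] In particular, $\mathcal M_{k,f}(\varepsilon)\in O\!\left(\frac{\log(1/\varepsilon)}{g^{-1}(\pi\varepsilon/2)}\right)$ as $\varepsilon\to0$. -/

import Mathlib

open MeasureTheory ProbabilityTheory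
open scoped NNReal ENNReal

namespace Contrastive

/-- The points of `X` whose label under `ℓ` differs from the label of `x`. -/
def opposite {X : Type*} (ℓ : Set X) (x : X) : Set X :=
  {y | ¬(y ∈ ℓ ↔ x ∈ ℓ)}

/-- The ideal (minimum distance) contrastive examples for `x`: the points of `X` that minimize the
distance to `x` among all limits of sequences of points labelled differently from `x`. -/
def ceMin {X : Type*} [MetricSpace X] (ℓ : Set X) (x : X) : Set X :=
  {p | p ∈ closure (opposite ℓ x) ∧ ∀ q ∈ closure (opposite ℓ x), dist x p ≤ dist x q}

/-- `D` is a family of distributions `D x` that the probabilistic approximate minimum distance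
mechanism with noise function `f` may use when the labelling rule is `ℓ`: `D x` lives on the points
labelled differently from `x`, and the expected distance of the contrastive example to some
ideal one, `p`, is at most `f (d (x, p))`. The second requirement is made at all points `x` that are
at positive distance from the differently labelled points; at distance zero from them it could
not be met if `f 0 = 0`. -/
structure IsProbAMDM {X : Type*} [MetricSpace X] [MeasurableSpace X]
    (f : ℝ≥0 → ℝ≥0) (ℓ : Set X) (D : Kernel X X) : Prop where
  markov : IsMarkovKernel D
  label_ne : ∀ x, ∀ᵐ x' ∂(D x), x' ∈ opposite ℓ x
  expected_dist : ∀ x, x ∉ closure (opposite ℓ x) →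
    ∃ p ∈ ceMin ℓ x, ∫⁻ x', edist x' p ∂(D x) ≤ (f (nndist x p) : ℝ≥0∞)

/-- The error of the concept `C` with respect to `ℓ`, where instances are drawn from `μ`. -/
noncomputable def err {X : Type*} [MeasurableSpace X] (μ : Measure X) (C ℓ : Set X) : ℝ≥0∞ :=
  μ {x | ¬(x ∈ ℓ ↔ x ∈ C)}

/-- A labelled primary example together with its labelled contrastive example. -/
abbrev LabeledPair (X : Type*) := (X × Prop) × (X × Prop)

/-- Attach the labels of `ℓ` to `m` pairs (primary instance, contrastive instance). -/
def attachLabels {X : Type*} (ℓ : Set X) {m : ℕ} (S : Fin m → X × X) : Fin m → LabeledPair X :=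
  fun i => (((S i).1, (S i).1 ∈ ℓ), ((S i).2, (S i).2 ∈ ℓ))

/-- A passive learner for the concept class `𝒞`: it maps the collected example pairs, in a way that
does not depend on their order, to a hypothesis in `𝒞`. Its error is measurable in the data,
so that its expected error makes sense. -/
structure PassiveLearner {X : Type*} [MeasurableSpace X] (μ : Measure X) (𝒞 : Set (Set X)) where
  hyp : (m : ℕ) → (Fin m → LabeledPair X) → Set X
  hyp_mem : ∀ m S, hyp m S ∈ 𝒞
  hyp_perm : ∀ m (σ : Equiv.Perm (Fin m)) S, hyp m (fun i => S (σ i)) = hyp m S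
  measurable_err : ∀ ℓ ∈ 𝒞, ∀ m,
    Measurable fun S : Fin m → X × X => err μ (hyp m (attachLabels ℓ S)) ℓ

/-- The joint law of `m` primary instances, drawn independently from `μ`, and their contrastive
instances, where the one for `x` is drawn independently from `D x`. -/
noncomputable def sampleLaw {X : Type*} [MeasurableSpace X] (μ : Measure X) (D : Kernel X X)
    (m : ℕ) : Measure (Fin m → X × X) :=
  Measure.pi fun _ => μ.compProd D

/-- The expected error of the hypothesis output by the learner after `m` example pairs. -/
noncomputable def expectedErr {X : Type*} [MeasurableSpace X] {μ : Measure X} {𝒞 : Set (Set X)}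
    (A : PassiveLearner μ 𝒞) (ℓ : Set X) (D : Kernel X X) (m : ℕ) : ℝ≥0∞ :=
  ∫⁻ S, err μ (A.hyp m (attachLabels ℓ S)) ℓ ∂(sampleLaw μ D m)

/-- The expected contrastive sample complexity of the learner `A` at accuracy `ε`, with respect to
the probabilistic mechanism with noise function `f`: the least `M` such that the expected error
is at most `ε` for every target in `𝒞`, every number `m ≥ M` of example pairs, and every
admissible family of contrastive distributions (`⊤` if there is no such `M`). -/
noncomputable def learnerComplexity {X : Type*} [MetricSpace X] [MeasurableSpace X]
    {μ : Measure X} {𝒞 : Set (Set X)} (f : ℝ≥0 → ℝ≥0) (A : PassiveLearner μ 𝒞) (ε : ℝ) : ℕ∞ :=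
  ⨅ (M : ℕ) (_ : ∀ ℓ ∈ 𝒞, ∀ m ≥ M, ∀ D : Kernel X X, IsProbAMDM f ℓ D →
    expectedErr A ℓ D m ≤ ENNReal.ofReal ε), (M : ℕ∞)

/-- The passive expected contrastive sample complexity of the concept class `𝒞`. -/
noncomputable def passiveComplexity {X : Type*} [MetricSpace X] [MeasurableSpace X]
    (μ : Measure X) (𝒞 : Set (Set X)) (f : ℝ≥0 → ℝ≥0) (ε : ℝ) : ℕ∞ :=
  ⨅ A : PassiveLearner μ 𝒞, learnerComplexity f A ε

/-- The closed Euclidean ball of radius `1/2` around the origin of `ℝ^k`. -/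
abbrev HalfBall (k : ℕ) : Type :=
  Metric.closedBall (0 : EuclideanSpace ℝ (Fin k)) (1 / 2)

/-- The uniform distribution on the ball: normalized Lebesgue measure. -/
noncomputable def uniformBall (k : ℕ) : Measure (HalfBall k) :=
  (volume (Metric.closedBall (0 : EuclideanSpace ℝ (Fin k)) (1 / 2)))⁻¹ •
    Measure.comap Subtype.val volume

/-- The class of homogeneous half-spaces over the ball. -/
def homHalfSpaces (k : ℕ) : Set (Set (HalfBall k)) :=
  {C | ∃ ω : EuclideanSpace ℝ (Fin k), C = {x : HalfBall k | 0 ≤ inner ℝ ω (x : EuclideanSpace ℝ (Fin k))}}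

end Contrastive

/-! For a target with unit normal `u`, a contrastive pair `(x, x')` nearly reveals `u`: with `a =
⟨u, x⟩`, the ideal `x'` is the foot of the perpendicular from `x`, at distance `|a|`, and the
direction of the pair is off by an angle whose tangent is at most (distance of `x'` to the foot) /
`|a|`. Its mean is at most `f |a| / |a| = g |a|`, so pairs near the hyperplane are the informative
ones. The learner cannot see `|a|`, but the observable distance of the pair bounds it from above
(`abs_inner_le_dist`); hence it sums the unit directions of all pairs at distance at most `r =
g⁻¹(πε/2)`.

Three facts carry the estimate. The error of a hypothesis is at most `3/(2π)` times the tangent of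
its angle with `u`, in every dimension (`volume_disagreement_le`). The tangent for a sum of unit
vectors is at most the average of their tangents (`norm_sub_inner_smul_div_le`), and the expectation
of that average over the close pairs is at most a conditional expectation (`lintegral_average_le`).
Finally, close pairs have `x` in the slab `|a| ≤ r`, and conversely have probability at least
`105/128` times the measure of that slab (`IsProbAMDM.le_compProd_closePairs`), so conditioning on
closeness costs only a factor `128/105`.

The slab has measure at least `2r` in every dimension. Thus all `m` pairs miss closeness with
probability at most `exp(-rm)`, which is at most `ε²` once `m ≥ 2 log(1/ε) / r`. The total is at
most `(32/35) ε + ε² ≤ ε`. -/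

namespace Contrastive

/-! ### Wedges between half-spaces whose normals lie in a common plane. -/

section Plane

variable {E : Type*} [NormedAddCommGroup E] [InnerProductSpace ℝ E]

/-- The part of the ball of radius `R` on which the half-spaces of `a` and `b` disagree. -/
def disagreement (R : ℝ) (a b : E) : Set E :=
  Metric.closedBall (0 : E) R ∩ {x | ¬(0 ≤ (inner ℝ a x : ℝ) ↔ 0 ≤ (inner ℝ b x : ℝ))}

theorem disagreement_comm (R : ℝ) (a b : E) : disagreement R a b = disagreement R b a := by
  ext x
  simp only [disagreement, Set.mem_inter_iff, Set.mem_ofPred_eq]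
  tauto

/-- The unit vector at angle `t` from `u` in the plane spanned by `u` and `w`. -/
noncomputable def planeVec (u w : E) (t : ℝ) : E := Real.cos t • u + Real.sin t • w

theorem inner_planeVec_mul_sin (u w x : E) (α β γ : ℝ) :
    inner ℝ (planeVec u w β) x * Real.sin (γ - α) =
      inner ℝ (planeVec u w α) x * Real.sin (γ - β) +
        inner ℝ (planeVec u w γ) x * Real.sin (β - α) := by
  simp only [planeVec, inner_add_left, real_inner_smul_left, Real.sin_sub]
  ring

theorem norm_planeVec {u w : E} (hu : ‖u‖ = 1) (hw : ‖w‖ = 1) (huw : inner ℝ u w = 0) (t : ℝ) :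
    ‖planeVec u w t‖ = 1 := by
  have : ‖planeVec u w t‖ ^ 2 = 1 := by
    rw [planeVec, norm_add_sq_real, norm_smul, norm_smul, hu, hw, real_inner_smul_left,
      inner_smul_right, huw]
    simp
  nlinarith [norm_nonneg (planeVec u w t)]

theorem inner_planeVec {u w : E} (hu : ‖u‖ = 1) (hw : ‖w‖ = 1) (huw : inner ℝ u w = 0)
    (s t : ℝ) : inner ℝ (planeVec u w s) (planeVec u w t) = Real.cos (s - t) := by
  simp only [planeVec, inner_add_left, inner_add_right, real_inner_smul_left, inner_smul_right,
    huw, real_inner_comm u w, real_inner_self_eq_norm_sq, hu, hw, Real.cos_sub]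
  ring

/-- Over a range of angles shorter than `π`, the sign of `⟨planeVec u w t, x⟩` changes at most once;
a common point of the two wedges would force two changes. -/
theorem disjoint_disagreement_planeVec (u w : E) (R : ℝ) {α α' β β' : ℝ} (h1 : α < α')
    (h2 : α' ≤ β) (h3 : β < β') (h4 : β' - α < Real.pi) :
    Disjoint (disagreement R (planeVec u w α) (planeVec u w α'))
      (disagreement R (planeVec u w β) (planeVec u w β')) := by
  have key : ∀ x a b c, a < b → b < c → c - a < Real.pi →
      ((0 ≤ inner ℝ (planeVec u w a) x ∧ 0 ≤ inner ℝ (planeVec u w c) x →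
        0 ≤ inner ℝ (planeVec u w b) x) ∧
      (inner ℝ (planeVec u w a) x < 0 ∧ inner ℝ (planeVec u w c) x < 0 →
        inner ℝ (planeVec u w b) x < 0)) := by
    intro x a b c hab hbc hca
    have e := inner_planeVec_mul_sin u w x a b c
    have s1 : 0 < Real.sin (c - a) := Real.sin_pos_of_pos_of_lt_pi (by linarith) (by linarith)
    have s2 : 0 < Real.sin (c - b) := Real.sin_pos_of_pos_of_lt_pi (by linarith) (by linarith)
    have s3 : 0 < Real.sin (b - a) := Real.sin_pos_of_pos_of_lt_pi (by linarith) (by linarith)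
    refine ⟨fun ⟨ha, hc⟩ => ?_, fun ⟨ha, hc⟩ => ?_⟩
    · by_contra! hb
      nlinarith [mul_nonneg ha s2.le, mul_nonneg hc s3.le, mul_neg_of_neg_of_pos hb s1]
    · by_contra! hb
      nlinarith [mul_neg_of_neg_of_pos ha s2, mul_neg_of_neg_of_pos hc s3, mul_nonneg hb s1.le]
  rw [Set.disjoint_left]
  rintro x ⟨-, hx⟩ ⟨-, hy⟩
  simp only [Set.mem_ofPred_eq] at hx hy
  have k1 := key x α α' β' h1 (by linarith) h4
  have k2 := key x α β β' (by linarith) h3 h4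
  rcases h2.eq_or_lt with rfl | h2
  · simp only [← not_le] at k1 k2
    grind
  have k3 := key x α α' β h1 h2 (by linarith)
  have k4 := key x α' β β' h2 h3 (by linarith)
  simp only [← not_le] at k1 k2 k3 k4
  generalize (0 ≤ inner ℝ (planeVec u w α) x) = p at *
  generalize (0 ≤ inner ℝ (planeVec u w α') x) = p' at *
  generalize (0 ≤ inner ℝ (planeVec u w β) x) = q at *
  generalize (0 ≤ inner ℝ (planeVec u w β') x) = q' at *
  clear key h1 h2 h3 h4
  grind

theorem measurableSet_disagreement [MeasurableSpace E] [BorelSpace E] (R : ℝ)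
    (a b : E) : MeasurableSet (disagreement R a b) := by
  have h : ∀ c : E, MeasurableSet {x : E | 0 ≤ (inner ℝ c x : ℝ)} := fun c =>
    (isClosed_le continuous_const (by fun_prop)).measurableSet
  exact Metric.isClosed_closedBall.measurableSet.inter ((h a).iff (h b)).compl

end Plane

/-! ### Dimension-free volume bounds for slabs and wedges of a ball. -/

section Volume

variable {E : Type*} [NormedAddCommGroup E] [InnerProductSpace ℝ E] [FiniteDimensional ℝ E]
  [MeasurableSpace E] [BorelSpace E]

/-- Contracting a centred ball towards the hyperplane orthogonal to `u` shows that thin slabs carry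
at least their linear share of the volume. -/
theorem mul_volume_slab_le (u : E) (hu : ‖u‖ = 1) (R : ℝ) {s : ℝ} (hs : 0 ≤ s) (hs1 : s ≤ 1)
    (r : ℝ) :
    ENNReal.ofReal s * volume (Metric.closedBall (0 : E) R ∩ {x | |inner ℝ u x| ≤ r}) ≤
      volume (Metric.closedBall (0 : E) R ∩ {x | |inner ℝ u x| ≤ s * r}) := by
  -- Scaling by `s` along `u`, identity on the orthogonal complement: determinant `1 + (s - 1) = s`.
  set A : E →ₗ[ℝ] E := LinearMap.transvection (innerₛₗ ℝ u) ((s - 1) • u) with hA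
  have hAx : ∀ x, A x = x + (inner ℝ u x * (s - 1)) • u := by
    intro x
    simp [hA, LinearMap.transvection.apply, smul_smul]
  have huu : inner ℝ u u = 1 := by rw [real_inner_self_eq_norm_sq, hu]; norm_num
  have hdet : LinearMap.det A = s := by
    rw [hA, LinearMap.transvection.det]
    simp [hu]
  have h := Measure.addHaar_image_linearMap (volume : Measure E) A
    (Metric.closedBall (0 : E) R ∩ {x | |inner ℝ u x| ≤ r})
  rw [hdet, abs_of_nonneg hs] at h
  rw [← h]
  apply measure_mono
  rintro _ ⟨x, ⟨hx, hxr⟩, rfl⟩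
  have hin : inner ℝ u (A x) = s * inner ℝ u x := by
    rw [hAx, inner_add_right, inner_smul_right, huu]; ring
  refine ⟨?_, ?_⟩
  · rw [mem_closedBall_zero_iff] at hx ⊢
    refine le_trans ?_ hx
    rw [← sq_le_sq₀ (norm_nonneg _) (norm_nonneg _), hAx, norm_add_sq_real, norm_smul, hu,
      inner_smul_right, real_inner_comm u x, Real.norm_eq_abs, mul_one, sq_abs]
    have : 0 ≤ (inner ℝ u x : ℝ) ^ 2 * (1 - s ^ 2) :=
      mul_nonneg (sq_nonneg _) (by nlinarith)
    nlinarith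
  · simp only [Set.mem_ofPred_eq] at hxr ⊢
    rw [hin, abs_mul, abs_of_nonneg hs]
    exact mul_le_mul_of_nonneg_left hxr hs

theorem volume_disagreement_map (R : ℝ) (e : E ≃ₗᵢ[ℝ] E) (a b : E) :
    volume (disagreement R (e a) (e b)) = volume (disagreement R a b) := by
  have h := e.measurePreserving.measure_preimage
    (measurableSet_disagreement R (e a) (e b)).nullMeasurableSet
  rw [← h]
  congr 1
  ext x
  simp [disagreement]

/-- Reflection in the line of the vector at angle `(j + 1)θ` exchanges neighbouring wedges, so all
wedges of opening `θ` in the sequence are congruent without constructing a rotation. -/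
theorem volume_disagreement_planeVec {u w : E} (hu : ‖u‖ = 1) (hw : ‖w‖ = 1)
    (huw : inner ℝ u w = 0) (R θ : ℝ) (j : ℕ) :
    volume (disagreement R (planeVec u w (j * θ)) (planeVec u w ((j + 1) * θ))) =
      volume (disagreement R (planeVec u w 0) (planeVec u w θ)) := by
  induction j with
  | zero => simp
  | succ j ih =>
    rw [← ih]
    push_cast
    set e := (Submodule.span ℝ {planeVec u w ((j + 1) * θ)}).reflection
    have he : ∀ t, e (planeVec u w t) = planeVec u w (2 * ((j + 1) * θ) - t) := by
      intro t
      rw [Submodule.reflection_singleton_apply, inner_planeVec hu hw huw,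
        norm_planeVec hu hw huw]
      obtain ⟨δ, rfl⟩ : ∃ δ, t = (j + 1) * θ - δ := ⟨(j + 1) * θ - t, by ring⟩
      have h1 : (j + 1) * θ - ((j + 1) * θ - δ) = δ := by ring
      have h2 : 2 * ((j + 1) * θ) - ((j + 1) * θ - δ) = (j + 1) * θ + δ := by ring
      rw [h1, h2]
      simp only [planeVec, Real.cos_sub, Real.sin_sub, Real.cos_add, Real.sin_add]
      simp only [RCLike.ofReal_real_eq_id, id_eq, one_pow, div_one]
      module
    have h := volume_disagreement_map R e (planeVec u w (j * θ)) (planeVec u w ((j + 1) * θ))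
    rw [he, he] at h
    rw [← h, disagreement_comm]
    congr 4 <;> ring

/-- A packing argument: `n` congruent wedges of total opening below `π` are disjoint inside the
ball. -/
theorem nsmul_volume_disagreement_le {u w : E} (hu : ‖u‖ = 1) (hw : ‖w‖ = 1)
    (huw : inner ℝ u w = 0) (R : ℝ) {θ : ℝ} (hθ : 0 < θ) (n : ℕ) (hn : n * θ < Real.pi) :
    n * volume (disagreement R (planeVec u w 0) (planeVec u w θ)) ≤
      volume (Metric.closedBall (0 : E) R) := by
  let S : Fin n → Set E := fun j =>
    disagreement R (planeVec u w (j * θ)) (planeVec u w ((j + 1) * θ))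
  have hlt : ∀ i j : Fin n, i < j → Disjoint (S i) (S j) := by
    intro i j hij
    have h1 : ((i : ℕ) : ℝ) + 1 ≤ (j : ℕ) := by exact_mod_cast hij
    have h2 : ((j : ℕ) : ℝ) + 1 ≤ n := by exact_mod_cast j.2
    have h3 : (0 : ℝ) ≤ (i : ℕ) := by positivity
    apply disjoint_disagreement_planeVec <;> nlinarith
  have hd : Pairwise (Function.onFun Disjoint S) := by
    intro i j hij
    rcases lt_or_gt_of_ne hij with h | h
    · exact hlt i j h
    · exact (hlt j i h).symm
  have h := measure_iUnion (μ := volume) hd (fun j => measurableSet_disagreement R _ _)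
  have hsum : ∑' j, volume (S j) =
      n * volume (disagreement R (planeVec u w 0) (planeVec u w θ)) := by
    rw [tsum_fintype]
    simp [S, volume_disagreement_planeVec hu hw huw]
  rw [← hsum, ← h]
  exact measure_mono (Set.iUnion_subset fun j => Set.inter_subset_left)

/-- The disagreement of the half-spaces of `u` and `u + t w` has relative volume at most
`3 / (2 π) * t`. -/
theorem volume_disagreement_add_smul_le {u w : E} (hu : ‖u‖ = 1) (hw : ‖w‖ = 1)
    (huw : inner ℝ u w = 0) (R : ℝ) {t : ℝ} (ht : 0 < t) :
    volume (disagreement R u (u + t • w)) ≤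
      ENNReal.ofReal (3 / (2 * Real.pi) * t) * volume (Metric.closedBall (0 : E) R) := by
  set θ := Real.arctan t with hθ
  have hpos : 0 < θ := by rw [hθ]; exact Real.arctan_pos.2 ht
  have hlt : θ < Real.pi / 2 := Real.arctan_lt_pi_div_two t
  have hcos : 0 < Real.cos θ := Real.cos_arctan_pos t
  have htan : θ ≤ t := by
    have := Real.le_tan hpos.le hlt
    rwa [hθ, Real.tan_arctan] at this
  have hv : planeVec u w θ = Real.cos θ • (u + t • w) := by
    have : Real.sin θ = Real.cos θ * t := by
      conv_rhs => rw [← Real.tan_arctan t, ← hθ, Real.tan_eq_sin_div_cos]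
      field_simp
    rw [planeVec, this]; module
  have hset : disagreement R u (u + t • w) =
      disagreement R (planeVec u w 0) (planeVec u w θ) := by
    ext x
    have h0 : planeVec u w 0 = u := by simp [planeVec]
    simp only [disagreement, hv, h0, real_inner_smul_left, mul_nonneg_iff_of_pos_left hcos]
  rw [hset]
  -- The largest `n` with `nθ < π` strictly, as disjointness requires. Since `θ < π/2` gives `n ≥
  -- 2`, we get `π ≤ (n + 1)θ ≤ (3/2) n θ ≤ (3/2) n t`; this is the origin of the constant `3/(2π)`.
  set n := ⌈Real.pi / θ⌉₊ - 1 with hn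
  have hq : 2 < Real.pi / θ := by rw [lt_div_iff₀ hpos]; linarith
  have hc : 3 ≤ ⌈Real.pi / θ⌉₊ := by
    have : (2 : ℕ) < ⌈Real.pi / θ⌉₊ := Nat.lt_ceil.2 (by exact_mod_cast hq)
    omega
  have hn1 : ((n : ℕ) : ℝ) + 1 = ⌈Real.pi / θ⌉₊ := by
    rw [hn, Nat.cast_sub (by omega)]; simp
  have hn2 : (2 : ℝ) ≤ n := by
    have : 2 ≤ n := by omega
    exact_mod_cast this
  have hnθ : n * θ < Real.pi := by
    have := Nat.ceil_lt_add_one (a := Real.pi / θ) (by positivity)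
    rw [← hn1] at this
    rw [← lt_div_iff₀ hpos]; linarith
  have h := nsmul_volume_disagreement_le hu hw huw R hpos n hnθ
  have hone : (1 : ℝ≥0∞) ≤ ENNReal.ofReal (3 / (2 * Real.pi) * t) * n := by
    rw [← ENNReal.ofReal_natCast, ← ENNReal.ofReal_mul (by positivity), ← ENNReal.ofReal_one]
    apply ENNReal.ofReal_le_ofReal
    have h1 : Real.pi / θ ≤ n + 1 := by rw [hn1]; exact Nat.le_ceil _
    rw [div_le_iff₀ hpos] at h1
    have h2 : Real.pi ≤ 3 / 2 * n * t := by nlinarith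
    have h3 : 3 / (2 * Real.pi) * t * n = 3 / 2 * n * t / Real.pi := by
      field_simp
    rw [h3, le_div_iff₀ Real.pi_pos]; linarith
  calc volume (disagreement R (planeVec u w 0) (planeVec u w θ))
      ≤ (ENNReal.ofReal (3 / (2 * Real.pi) * t) * n) *
        volume (disagreement R (planeVec u w 0) (planeVec u w θ)) := le_mul_of_one_le_left' hone
    _ ≤ _ := by rw [mul_assoc]; gcongr

/-- The disagreement of a half-space with that of a vector `v` on the positive side is controlled
by the tangent of the angle between their normals. -/
theorem volume_disagreement_le {u : E} (hu : ‖u‖ = 1) (R : ℝ) {v : E} (hv : 0 < inner ℝ v u) :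
    volume (disagreement R u v) ≤
      ENNReal.ofReal (3 / (2 * Real.pi) * (‖v - inner ℝ v u • u‖ / inner ℝ v u)) *
        volume (Metric.closedBall (0 : E) R) := by
  set c : ℝ := inner ℝ v u
  set l := v - c • u with hl
  have huu : inner ℝ u u = (1 : ℝ) := by rw [real_inner_self_eq_norm_sq, hu]; norm_num
  have hul : inner ℝ u l = (0 : ℝ) := by
    rw [hl, inner_sub_right, inner_smul_right, huu, real_inner_comm]; simp [c]
  have hscale : ∀ v' : E, v = c • v' → disagreement R u v = disagreement R u v' := by
    intro v' h
    ext x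
    simp only [disagreement, h, real_inner_smul_left, mul_nonneg_iff_of_pos_left hv]
  by_cases h0 : l = 0
  · rw [hscale u (by rw [← sub_eq_zero]; exact h0)]
    simp [disagreement]
  · have hpos : 0 < ‖l‖ := norm_pos_iff.2 h0
    rw [hscale (u + (‖l‖ / c) • ((‖l‖)⁻¹ • l)) (by
      rw [smul_smul, smul_add, smul_smul]
      have : c * (‖l‖ / c * ‖l‖⁻¹) = 1 := by field_simp
      rw [this, hl]; module)]
    apply volume_disagreement_add_smul_le hu
    · rw [norm_smul, norm_inv, norm_norm, inv_mul_cancel₀ hpos.ne']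
    · rw [inner_smul_right, hul, mul_zero]
    · positivity

end Volume

/-! ### Averages over a random subsample. -/

section Averaging

variable {α : Type*} [MeasurableSpace α] (ν : Measure α) [IsProbabilityMeasure ν]

/-- When the `i`-th point lies in `B`, the count is one plus the count over the other points, which
is independent of it; the integral therefore factors. -/
theorem lintegral_indicator_mul_inv_count {n : ℕ} {B : Set α} (hB : MeasurableSet B)
    {ψ : α → ℝ≥0∞} (hψ : Measurable ψ) (i : Fin (n + 1)) :
    ∫⁻ S, B.indicator ψ (S i) * (∑ j, B.indicator 1 (S j))⁻¹
        ∂(Measure.pi fun _ : Fin (n + 1) => ν) =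
      (∫⁻ x in B, ψ x ∂ν) *
        ∫⁻ T, (1 + ∑ j, B.indicator 1 (T j))⁻¹ ∂(Measure.pi fun _ : Fin n => ν) := by
  have hind : Measurable (B.indicator (1 : α → ℝ≥0∞)) := measurable_one.indicator hB
  have hG : Measurable fun T : Fin n → α => (1 + ∑ j, B.indicator (1 : α → ℝ≥0∞) (T j))⁻¹ := by
    fun_prop
  have hF : Measurable (B.indicator ψ) := hψ.indicator hB
  have hmp := measurePreserving_piFinSuccAbove (fun _ : Fin (n + 1) => ν) i
  let H : α × (Fin n → α) → ℝ≥0∞ := fun z => B.indicator ψ z.1 *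
    (1 + ∑ j, B.indicator (1 : α → ℝ≥0∞) (z.2 j))⁻¹
  have hH : Measurable H := (hF.comp measurable_fst).mul (hG.comp measurable_snd)
  have hpt : ∀ S : Fin (n + 1) → α,
      B.indicator ψ (S i) * (∑ j, B.indicator (1 : α → ℝ≥0∞) (S j))⁻¹ =
        H (MeasurableEquiv.piFinSuccAbove (fun _ => α) i S) := by
    intro S
    by_cases h : S i ∈ B
    · rw [Fin.sum_univ_succAbove _ i]
      simp [H, MeasurableEquiv.piFinSuccAbove, Fin.insertNthEquiv, Fin.removeNth, h]
    · simp [H, MeasurableEquiv.piFinSuccAbove, Fin.insertNthEquiv, h]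
  rw [lintegral_congr hpt, hmp.lintegral_comp hH,
    lintegral_prod_mul hF.aemeasurable hG.aemeasurable, lintegral_indicator hB]

/-- The average of a function over those sample points that fall into `B` has expectation at most
the conditional expectation of the function given `B`. -/
theorem lintegral_average_le (m : ℕ) {B : Set α} (hB : MeasurableSet B) (hB0 : ν B ≠ 0)
    {ψ : α → ℝ≥0∞} (hψ : Measurable ψ) :
    ∫⁻ S, (∑ i, B.indicator ψ (S i)) * (∑ j, B.indicator 1 (S j))⁻¹
        ∂(Measure.pi fun _ : Fin m => ν) ≤ (∫⁻ x in B, ψ x ∂ν) / ν B := by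
  cases m with
  | zero => simp
  | succ n =>
    have hind : Measurable (B.indicator (1 : α → ℝ≥0∞)) := measurable_one.indicator hB
    set G := ∫⁻ T, (1 + ∑ j, B.indicator 1 (T j))⁻¹ ∂(Measure.pi fun _ : Fin n => ν) with hG
    have key : ∀ φ : α → ℝ≥0∞, Measurable φ →
        ∫⁻ S, (∑ i, B.indicator φ (S i)) * (∑ j, B.indicator 1 (S j))⁻¹
          ∂(Measure.pi fun _ : Fin (n + 1) => ν) = (n + 1) * ((∫⁻ x in B, φ x ∂ν) * G) := by
      intro φ hφ
      have hF : Measurable (B.indicator φ) := hφ.indicator hB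
      simp_rw [Finset.sum_mul]
      rw [lintegral_finsetSum _ (fun i _ => by fun_prop)]
      simp_rw [lintegral_indicator_mul_inv_count ν hB hφ]
      simp [hG]
    -- The factor `G` does not depend on the averaged function, so the constant function `1` bounds
    -- it without computing binomial moments. An empty subsample contributes `0 * ⊤ = 0`.
    have h1 : (n + 1) * (ν B * G) ≤ 1 := by
      have h := key 1 measurable_one
      simp only [Pi.one_apply, lintegral_const, one_mul, Measure.restrict_apply_univ] at h
      rw [← h]
      calc _ ≤ ∫⁻ _, 1 ∂(Measure.pi fun _ : Fin (n + 1) => ν) :=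
            lintegral_mono fun S => ENNReal.mul_inv_le_one _
        _ = 1 := by simp
    rw [key ψ hψ, ENNReal.le_div_iff_mul_le (Or.inl hB0) (Or.inl (measure_ne_top _ _))]
    calc (n + 1) * ((∫⁻ x in B, ψ x ∂ν) * G) * ν B
        = (∫⁻ x in B, ψ x ∂ν) * ((n + 1) * (ν B * G)) := by ring
      _ ≤ (∫⁻ x in B, ψ x ∂ν) * 1 := by gcongr
      _ = _ := mul_one _

theorem measure_pi_forall_notMem (m : ℕ) {B : Set α} (hB : MeasurableSet B) :
    (Measure.pi fun _ : Fin m => ν) {S | ∀ i, S i ∉ B} = (1 - ν B) ^ m := by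
  have h : {S : Fin m → α | ∀ i, S i ∉ B} = Set.univ.pi fun _ => Bᶜ := by
    ext S; simp
  rw [h, Measure.pi_pi]
  simp [prob_compl_eq_one_sub hB]

end Averaging

/-! ### The uniform distribution on the ball of radius `1/2`. -/

section Ball

variable {k : ℕ}

theorem uniformBall_preimage (s : Set (EuclideanSpace ℝ (Fin k))) :
    uniformBall k (Subtype.val ⁻¹' s) =
      (volume (Metric.closedBall (0 : EuclideanSpace ℝ (Fin k)) (1 / 2)))⁻¹ *
        volume (Metric.closedBall (0 : EuclideanSpace ℝ (Fin k)) (1 / 2) ∩ s) := by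
  have he := MeasurableEmbedding.subtype_coe
    (Metric.isClosed_closedBall (x := (0 : EuclideanSpace ℝ (Fin k))) (ε := 1 / 2)).measurableSet
  rw [uniformBall, Measure.smul_apply, smul_eq_mul, he.comap_apply,
    Subtype.image_preimage_coe]

theorem volume_halfBall_ne_zero :
    volume (Metric.closedBall (0 : EuclideanSpace ℝ (Fin k)) (1 / 2)) ≠ 0 :=
  (Metric.measure_closedBall_pos _ _ (by norm_num)).ne'

theorem volume_halfBall_ne_top :
    volume (Metric.closedBall (0 : EuclideanSpace ℝ (Fin k)) (1 / 2)) ≠ ∞ :=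
  measure_closedBall_lt_top.ne

instance isProbabilityMeasure_uniformBall : IsProbabilityMeasure (uniformBall k) where
  measure_univ := by
    have h := uniformBall_preimage (k := k) Set.univ
    rw [Set.preimage_univ, Set.inter_univ,
      ENNReal.inv_mul_cancel volume_halfBall_ne_zero volume_halfBall_ne_top] at h
    exact h

/-- The half-space with normal `v`, as a subset of the ball. -/
def halfSpace (v : EuclideanSpace ℝ (Fin k)) : Set (HalfBall k) :=
  {x | 0 ≤ inner ℝ v (x : EuclideanSpace ℝ (Fin k))}

theorem mem_halfSpace {v : EuclideanSpace ℝ (Fin k)} {x : HalfBall k} :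
    x ∈ halfSpace v ↔ 0 ≤ inner ℝ v (x : EuclideanSpace ℝ (Fin k)) := Iff.rfl

theorem measurableSet_halfSpace (v : EuclideanSpace ℝ (Fin k)) : MeasurableSet (halfSpace v) :=
  (isClosed_le continuous_const (by fun_prop)).measurableSet

theorem err_halfSpace_le {u : EuclideanSpace ℝ (Fin k)} (hu : ‖u‖ = 1)
    {v : EuclideanSpace ℝ (Fin k)} (hv : 0 < inner ℝ v u) :
    err (uniformBall k) (halfSpace v) (halfSpace u) ≤
      ENNReal.ofReal (3 / (2 * Real.pi) * (‖v - inner ℝ v u • u‖ / inner ℝ v u)) := by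
  have h := volume_disagreement_le hu (1 / 2) hv
  have hset : {x : HalfBall k | ¬(x ∈ halfSpace u ↔ x ∈ halfSpace v)} =
      Subtype.val ⁻¹' disagreement (1 / 2) u v := by
    ext x
    have := x.2
    simp only [disagreement, mem_halfSpace, Set.mem_preimage, Set.mem_inter_iff,
      Set.mem_ofPred_eq, this, true_and]
  rw [err, hset, uniformBall_preimage,
    ENNReal.inv_mul_le_iff volume_halfBall_ne_zero volume_halfBall_ne_top, mul_comm]
  exact (measure_mono Set.inter_subset_right).trans h

/-- The points of the ball at distance at most `t` from the hyperplane orthogonal to `u`. -/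
def slab (u : EuclideanSpace ℝ (Fin k)) (t : ℝ) : Set (HalfBall k) :=
  {x | |inner ℝ u (x : EuclideanSpace ℝ (Fin k))| ≤ t}

theorem measurableSet_slab (u : EuclideanSpace ℝ (Fin k)) (t : ℝ) : MeasurableSet (slab u t) :=
  (isClosed_le (by fun_prop) continuous_const).measurableSet

theorem mul_uniformBall_slab_le {u : EuclideanSpace ℝ (Fin k)} (hu : ‖u‖ = 1) {s : ℝ}
    (hs : 0 ≤ s) (hs1 : s ≤ 1) (r : ℝ) :
    ENNReal.ofReal s * uniformBall k (slab u r) ≤ uniformBall k (slab u (s * r)) := by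
  have hset : ∀ t, slab u t =
      Subtype.val ⁻¹' {x : EuclideanSpace ℝ (Fin k) | |inner ℝ u x| ≤ t} := fun t => rfl
  rw [hset, hset, uniformBall_preimage, uniformBall_preimage, mul_left_comm]
  gcongr
  exact mul_volume_slab_le u hu _ hs hs1 r

/-- The slab of half-width `1/2` is the whole ball; contract it by the factor `2r`. -/
theorem two_mul_le_uniformBall_slab {u : EuclideanSpace ℝ (Fin k)} (hu : ‖u‖ = 1) {r : ℝ}
    (hr : 0 ≤ r) (hr1 : r ≤ 1 / 2) :
    ENNReal.ofReal (2 * r) ≤ uniformBall k (slab u r) := by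
  have h := mul_uniformBall_slab_le hu (s := 2 * r) (by linarith) (by linarith) (1 / 2)
  have huniv : slab u (1 / 2) = Set.univ := by
    refine Set.eq_univ_of_forall fun x => (abs_real_inner_le_norm _ _).trans ?_
    rw [hu, one_mul]
    exact mem_closedBall_zero_iff.1 x.2
  rw [huniv, measure_univ, mul_one] at h
  convert h using 3
  ring

theorem uniformBall_ae_inner_ne_zero {u : EuclideanSpace ℝ (Fin k)} (hu : ‖u‖ = 1) :
    ∀ᵐ x : HalfBall k ∂(uniformBall k), inner ℝ u (x : EuclideanSpace ℝ (Fin k)) ≠ 0 := by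
  have hset : {x : HalfBall k | ¬ inner ℝ u (x : EuclideanSpace ℝ (Fin k)) ≠ 0} =
      Subtype.val ⁻¹' ((innerₛₗ ℝ u).ker : Set (EuclideanSpace ℝ (Fin k))) := by
    ext x; simp
  have hker : volume ((innerₛₗ ℝ u).ker : Set (EuclideanSpace ℝ (Fin k))) = 0 := by
    apply Measure.addHaar_submodule
    intro h
    have : u ∈ (innerₛₗ ℝ u).ker := h ▸ Submodule.mem_top
    rw [LinearMap.mem_ker, innerₛₗ_apply_apply, real_inner_self_eq_norm_sq, hu] at this
    norm_num at this
  rw [ae_iff, hset, uniformBall_preimage,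
    measure_mono_null Set.inter_subset_right hker, mul_zero]

end Ball

/-! ### Ideal contrastive examples for half-spaces. -/

section Contrast

variable {k : ℕ}

theorem inner_mul_inner_nonpos_of_mem_closure {u : EuclideanSpace ℝ (Fin k)} {x y : HalfBall k}
    (hy : y ∈ closure (opposite (halfSpace u) x)) :
    inner ℝ u (x : EuclideanSpace ℝ (Fin k)) * inner ℝ u (y : EuclideanSpace ℝ (Fin k)) ≤ 0 := by
  have hcl : IsClosed {y : HalfBall k | inner ℝ u (x : EuclideanSpace ℝ (Fin k)) *
      inner ℝ u (y : EuclideanSpace ℝ (Fin k)) ≤ 0} :=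
    isClosed_le (by fun_prop) continuous_const
  refine closure_minimal ?_ hcl hy
  intro z hz
  simp only [opposite, Set.mem_ofPred_eq, mem_halfSpace] at hz ⊢
  rcases le_or_gt 0 (inner ℝ u (x : EuclideanSpace ℝ (Fin k))) with h | h
  · have : inner ℝ u (z : EuclideanSpace ℝ (Fin k)) < 0 := by
      by_contra! h'; exact hz (by simp [h, h'])
    exact mul_nonpos_of_nonneg_of_nonpos h this.le
  · have : 0 ≤ inner ℝ u (z : EuclideanSpace ℝ (Fin k)) := by
      by_contra! h'; exact hz (by simp [h.not_ge, h'.not_ge])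
    exact mul_nonpos_of_nonpos_of_nonneg h.le this

theorem notMem_closure_opposite {u : EuclideanSpace ℝ (Fin k)} {x : HalfBall k}
    (hx : inner ℝ u (x : EuclideanSpace ℝ (Fin k)) ≠ 0) :
    x ∉ closure (opposite (halfSpace u) x) := fun h =>
  (mul_self_pos.2 hx).not_ge (inner_mul_inner_nonpos_of_mem_closure h)

/-- The foot of the perpendicular from `x` to the hyperplane orthogonal to the unit vector `u`. -/
noncomputable def foot (u x : EuclideanSpace ℝ (Fin k)) : EuclideanSpace ℝ (Fin k) := x - inner ℝ u x • u

theorem inner_foot {u : EuclideanSpace ℝ (Fin k)} (hu : ‖u‖ = 1)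
    (x : EuclideanSpace ℝ (Fin k)) : inner ℝ u (foot u x) = 0 := by
  rw [foot, inner_sub_right, inner_smul_right, real_inner_self_eq_norm_sq, hu]; ring

theorem norm_foot_le {u : EuclideanSpace ℝ (Fin k)} (hu : ‖u‖ = 1)
    (x : EuclideanSpace ℝ (Fin k)) : ‖foot u x‖ ≤ ‖x‖ := by
  rw [← sq_le_sq₀ (norm_nonneg _) (norm_nonneg _), foot, norm_sub_sq_real, norm_smul, hu,
    inner_smul_right, real_inner_comm u x, Real.norm_eq_abs, mul_one, sq_abs]
  nlinarith [sq_nonneg (inner ℝ u x : ℝ)]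

/-- Moving the foot slightly towards the pole of the ball on the side away from `x` stays in the
ball by convexity and lands strictly across the hyperplane, so the label convention on the
hyperplane is immaterial. -/
theorem foot_mem_closure_opposite {u : EuclideanSpace ℝ (Fin k)} (hu : ‖u‖ = 1) {x q : HalfBall k}
    (hx : inner ℝ u (x : EuclideanSpace ℝ (Fin k)) ≠ 0)
    (hq : (q : EuclideanSpace ℝ (Fin k)) = foot u x) :
    q ∈ closure (opposite (halfSpace u) x) := by
  set a : ℝ := inner ℝ u (x : EuclideanSpace ℝ (Fin k)) with ha
  have ha' : 0 < |a| := abs_pos.2 hx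
  rw [Metric.mem_closure_iff]
  intro ε hε
  obtain ⟨t, ht0, ht1, htε⟩ : ∃ t : ℝ, 0 < t ∧ t ≤ 1 ∧ t < ε :=
    ⟨min 1 (ε / 2), by positivity, min_le_left _ _, (min_le_right _ _).trans_lt (by linarith)⟩
  have hqn : ‖(q : EuclideanSpace ℝ (Fin k))‖ ≤ 1 / 2 := mem_closedBall_zero_iff.1 q.2
  have hbn : ‖(a / (2 * |a|)) • u‖ = 1 / 2 := by
    rw [norm_smul, hu, mul_one, Real.norm_eq_abs, abs_div, abs_mul, abs_abs]
    simp only [Nat.abs_ofNat]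
    field_simp
  set y : EuclideanSpace ℝ (Fin k) := (1 - t) • (q : EuclideanSpace ℝ (Fin k)) -
    t • (a / (2 * |a|)) • u with hy
  have hyn : ‖y‖ ≤ 1 / 2 := by
    refine (norm_sub_le _ _).trans ?_
    rw [norm_smul, norm_smul, hbn, Real.norm_eq_abs, Real.norm_eq_abs, abs_of_pos ht0,
      abs_of_nonneg (by linarith)]
    nlinarith
  have hyu : a * inner ℝ u y < 0 := by
    rw [hy, inner_sub_right, inner_smul_right, hq, inner_foot hu, inner_smul_right,
      inner_smul_right, real_inner_self_eq_norm_sq, hu]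
    have : a * ((1 - t) * 0 - t * (a / (2 * |a|) * 1 ^ 2)) = -(t * (a * a) / (2 * |a|)) := by
      ring
    rw [this, neg_lt_zero]
    have := mul_self_pos.2 hx
    positivity
  refine ⟨⟨y, mem_closedBall_zero_iff.2 hyn⟩, ?_, ?_⟩
  · simp only [opposite, Set.mem_ofPred_eq, mem_halfSpace]
    intro h
    rcases lt_or_gt_of_ne hx with h' | h'
    · have := neg_of_mul_neg_right hyu
      nlinarith [h.not.2 h'.not_ge]
    · nlinarith [h.2 h'.le]
  · rw [Subtype.dist_eq, dist_eq_norm]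
    have : (q : EuclideanSpace ℝ (Fin k)) - y =
        t • ((q : EuclideanSpace ℝ (Fin k)) + (a / (2 * |a|)) • u) := by
      rw [hy]; module
    simp only [this]
    rw [norm_smul, Real.norm_eq_abs, abs_of_pos ht0]
    have := norm_add_le (q : EuclideanSpace ℝ (Fin k)) ((a / (2 * |a|)) • u)
    nlinarith

/-- For a half-space the ideal contrastive example is the foot of the perpendicular. -/
theorem coe_eq_foot_of_mem_ceMin {u : EuclideanSpace ℝ (Fin k)} (hu : ‖u‖ = 1) {x p : HalfBall k}
    (hx : inner ℝ u (x : EuclideanSpace ℝ (Fin k)) ≠ 0) (hp : p ∈ ceMin (halfSpace u) x) :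
    (p : EuclideanSpace ℝ (Fin k)) = foot u x := by
  set a : ℝ := inner ℝ u (x : EuclideanSpace ℝ (Fin k)) with ha
  let q : HalfBall k := ⟨foot u x, mem_closedBall_zero_iff.2
    ((norm_foot_le hu _).trans (mem_closedBall_zero_iff.1 x.2))⟩
  have h1 := hp.2 q (foot_mem_closure_opposite hu hx rfl)
  have h2 := inner_mul_inner_nonpos_of_mem_closure hp.1
  rw [← ha] at h2
  have h3 : ‖(x : EuclideanSpace ℝ (Fin k)) - p‖ ^ 2 ≤ a ^ 2 := by
    rw [Subtype.dist_eq, Subtype.dist_eq, dist_eq_norm, dist_eq_norm] at h1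
    have : (x : EuclideanSpace ℝ (Fin k)) - (q : EuclideanSpace ℝ (Fin k)) = a • u := by
      simp [q, foot, ha]
    rw [this, norm_smul, hu, mul_one, Real.norm_eq_abs] at h1
    have := abs_mul_abs_self a
    nlinarith [norm_nonneg ((x : EuclideanSpace ℝ (Fin k)) - p), abs_nonneg a]
  -- The square equals `‖x - p‖² - a² + 2a⟨u, p⟩`: `h3` bounds the first difference and `h2` the
  -- last term.
  have h4 : ‖((x : EuclideanSpace ℝ (Fin k)) - p) - a • u‖ ^ 2 ≤ 0 := by
    rw [norm_sub_sq_real, norm_smul, hu, inner_smul_right, inner_sub_left, real_inner_comm,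
      ← ha, real_inner_comm, Real.norm_eq_abs, mul_one, sq_abs]
    nlinarith
  have h5 : ((x : EuclideanSpace ℝ (Fin k)) - p) - a • u = 0 := by
    rw [← norm_eq_zero]; nlinarith [norm_nonneg (((x : EuclideanSpace ℝ (Fin k)) - p) - a • u)]
  rw [sub_eq_zero] at h5
  rw [foot, ← ha, ← h5, sub_sub_cancel]

/-- The distance of the contrastive example from the ideal one, relative to the distance of the
primary example from the hyperplane orthogonal to `u`. -/
noncomputable def relDev (u : EuclideanSpace ℝ (Fin k)) (z : HalfBall k × HalfBall k) : ℝ≥0∞ :=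
  ‖(z.2 : EuclideanSpace ℝ (Fin k)) - foot u z.1‖ₑ /
    ‖(inner ℝ u (z.1 : EuclideanSpace ℝ (Fin k)) : ℝ)‖ₑ

theorem measurable_relDev (u : EuclideanSpace ℝ (Fin k)) : Measurable (relDev u) := by
  unfold relDev foot
  fun_prop

/-- The segment from `x` to `y` crosses the hyperplane. Hence a close pair has its primary example
in a thin slab. -/
theorem abs_inner_le_dist {u : EuclideanSpace ℝ (Fin k)} (hu : ‖u‖ = 1) {x y : HalfBall k}
    (hy : y ∈ opposite (halfSpace u) x) :
    |inner ℝ u (x : EuclideanSpace ℝ (Fin k))| ≤ dist x y := by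
  have h := inner_mul_inner_nonpos_of_mem_closure (subset_closure hy)
  have h1 : |inner ℝ u (x : EuclideanSpace ℝ (Fin k))| ≤
      |inner ℝ u ((x : EuclideanSpace ℝ (Fin k)) - y)| := by
    rw [inner_sub_right, ← sq_le_sq]
    nlinarith [sq_nonneg (inner ℝ u (y : EuclideanSpace ℝ (Fin k)) : ℝ)]
  rw [Subtype.dist_eq, dist_eq_norm]
  simpa [hu] using h1.trans (abs_real_inner_le_norm u _)

theorem IsProbAMDM.lintegral_enorm_sub_foot_le {f : ℝ≥0 → ℝ≥0} {u : EuclideanSpace ℝ (Fin k)}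
    (hu : ‖u‖ = 1) {D : Kernel (HalfBall k) (HalfBall k)} (hD : IsProbAMDM f (halfSpace u) D)
    {x : HalfBall k} (hx : inner ℝ u (x : EuclideanSpace ℝ (Fin k)) ≠ 0) :
    ∫⁻ y, ‖(y : EuclideanSpace ℝ (Fin k)) - foot u x‖ₑ ∂(D x) ≤
      f ‖(inner ℝ u (x : EuclideanSpace ℝ (Fin k)) : ℝ)‖₊ := by
  obtain ⟨p, hp, h⟩ := hD.expected_dist x (notMem_closure_opposite hx)
  have hpf := coe_eq_foot_of_mem_ceMin hu hx hp
  have hd : nndist x p = ‖(inner ℝ u (x : EuclideanSpace ℝ (Fin k)) : ℝ)‖₊ := by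
    rw [Subtype.nndist_eq, nndist_eq_nnnorm, hpf, foot, sub_sub_cancel, nnnorm_smul]
    have : ‖u‖₊ = 1 := by ext; simpa using hu
    rw [this, mul_one]
  rw [hd] at h
  simpa [Subtype.edist_eq, edist_eq_enorm_sub, hpf] using h

end Contrast

/-! ### The averaging learner and its error on a fixed sample. -/

section Learner

/-- The tangent of the angle between `u` and a sum of unit vectors on the positive side of `u` is at
most the average of the tangents of their angles with `u`. -/
theorem norm_sub_inner_smul_div_le {E ι : Type*} [NormedAddCommGroup E] [InnerProductSpace ℝ E]
    {u : E} (hu : ‖u‖ = 1) {I : Finset ι} (hI : I.Nonempty) (n : ι → E) (t : ι → ℝ)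
    (hn : ∀ i ∈ I, ‖n i‖ = 1) (hc : ∀ i ∈ I, 0 < inner ℝ (n i) u)
    (ht : ∀ i ∈ I, ‖n i - inner ℝ (n i) u • u‖ / inner ℝ (n i) u ≤ t i) :
    0 < inner ℝ (∑ i ∈ I, n i) u ∧
      ‖∑ i ∈ I, n i - inner ℝ (∑ i ∈ I, n i) u • u‖ / inner ℝ (∑ i ∈ I, n i) u ≤
        (∑ i ∈ I, t i) / I.card := by
  set c : ι → ℝ := fun i => inner ℝ (n i) u with hcdef
  set g : ι → ℝ := fun i => ‖n i - c i • u‖ / c i with hg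
  have hsq : ∀ i ∈ I, ‖n i - c i • u‖ ^ 2 = 1 - c i ^ 2 := by
    intro i hi
    rw [norm_sub_sq_real, norm_smul, hn i hi, hu, inner_smul_right, Real.norm_eq_abs, mul_one,
      sq_abs]
    simp only [hcdef]
    ring
  -- For unit vectors a larger cosine `c i` means a smaller tangent `g i`, so Chebyshev's sum
  -- inequality bounds `|I| ∑ c g` by `(∑ c)(∑ g)`, where `c g` is the length of the lateral part.
  have hanti : AntivaryOn c g I := by
    intro i hi j hj hij
    by_contra! hlt
    have hi0 : 0 < c i := hc i hi
    have h1 : ‖n j - c j • u‖ ≤ ‖n i - c i • u‖ := by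
      rw [← sq_le_sq₀ (norm_nonneg _) (norm_nonneg _), hsq i hi, hsq j hj]
      nlinarith
    exact hij.not_ge (div_le_div₀ (norm_nonneg _) h1 hi0 hlt.le)
  have hcheb := hanti.card_mul_sum_le_sum_mul_sum
  have hcg : ∑ i ∈ I, c i * g i = ∑ i ∈ I, ‖n i - c i • u‖ :=
    Finset.sum_congr rfl fun i hi => mul_div_cancel₀ _ (hc i hi).ne'
  rw [hcg] at hcheb
  have hin : inner ℝ (∑ i ∈ I, n i) u = ∑ i ∈ I, c i := sum_inner _ _ _
  have hpos : 0 < ∑ i ∈ I, c i := Finset.sum_pos hc hI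
  have hcard : (0 : ℝ) < I.card := by exact_mod_cast hI.card_pos
  rw [hin]
  refine ⟨hpos, ?_⟩
  rw [Finset.sum_smul, ← Finset.sum_sub_distrib, div_le_div_iff₀ hpos hcard]
  calc ‖∑ i ∈ I, (n i - c i • u)‖ * I.card
      ≤ (∑ i ∈ I, ‖n i - c i • u‖) * I.card := by gcongr; exact norm_sum_le _ _
    _ ≤ (∑ i ∈ I, c i) * ∑ i ∈ I, g i := by rw [mul_comm]; exact hcheb
    _ ≤ (∑ i ∈ I, c i) * ∑ i ∈ I, t i :=
        mul_le_mul_of_nonneg_left (Finset.sum_le_sum ht) hpos.le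
    _ = _ := mul_comm _ _

variable {k : ℕ}

open Classical in
/-- The unit vector pointing from the negative to the positive example of a pair, if the two are at
distance at most `r`, and zero otherwise. -/
noncomputable def pairDir (r : ℝ) (z : LabeledPair (HalfBall k)) : EuclideanSpace ℝ (Fin k) :=
  if dist z.1.1 z.2.1 ≤ r then
    ((if z.1.2 then 1 else -1) * (dist z.1.1 z.2.1)⁻¹ : ℝ) •
      ((z.1.1 : EuclideanSpace ℝ (Fin k)) - z.2.1)
  else 0

theorem measurable_pairDir_attachLabels (r : ℝ) {ℓ : Set (HalfBall k)} (hℓ : MeasurableSet ℓ)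
    {m : ℕ} (i : Fin m) :
    Measurable fun S : Fin m → HalfBall k × HalfBall k => pairDir r (attachLabels ℓ S i) := by
  classical
  have hσ : Measurable fun z : HalfBall k × HalfBall k => if z.1 ∈ ℓ then (1 : ℝ) else -1 :=
    Measurable.ite (measurable_fst hℓ) measurable_const measurable_const
  have hdir : Measurable fun z : HalfBall k × HalfBall k =>
      ((if z.1 ∈ ℓ then 1 else -1) * (dist z.1 z.2)⁻¹ : ℝ) •
        ((z.1 : EuclideanSpace ℝ (Fin k)) - z.2) := by
    fun_prop
  have h : Measurable fun z : HalfBall k × HalfBall k =>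
      if dist z.1 z.2 ≤ r then ((if z.1 ∈ ℓ then 1 else -1) * (dist z.1 z.2)⁻¹ : ℝ) •
        ((z.1 : EuclideanSpace ℝ (Fin k)) - z.2) else 0 :=
    Measurable.ite (measurableSet_le (by fun_prop) measurable_const) hdir measurable_const
  have hi : Measurable fun S : Fin m → HalfBall k × HalfBall k => S i := measurable_pi_apply i
  convert h.comp hi using 2 with S
  simp only [pairDir, attachLabels, Function.comp_apply]
  congr!

theorem measurable_err_halfSpace {ℓ : Set (HalfBall k)} (hℓ : MeasurableSet ℓ) :
    Measurable fun v : EuclideanSpace ℝ (Fin k) => err (uniformBall k) (halfSpace v) ℓ := by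
  have hs : MeasurableSet {z : EuclideanSpace ℝ (Fin k) × HalfBall k |
      ¬(z.2 ∈ ℓ ↔ z.2 ∈ halfSpace z.1)} := by
    refine (MeasurableSet.iff (measurable_snd hℓ) ?_).compl
    exact (isClosed_le continuous_const (by fun_prop) :
      IsClosed {z : EuclideanSpace ℝ (Fin k) × HalfBall k |
        0 ≤ inner ℝ z.1 (z.2 : EuclideanSpace ℝ (Fin k))}).measurableSet
  exact measurable_measure_prodMk_left (ν := uniformBall k) hs

/-- The learner that averages the directions of all pairs at distance at most `r`. -/
noncomputable def averagingLearner (k : ℕ) (r : ℝ) :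
    PassiveLearner (uniformBall k) (homHalfSpaces k) where
  hyp _ S := halfSpace (∑ i, pairDir r (S i))
  hyp_mem _ _ := ⟨_, rfl⟩
  hyp_perm m σ S := by rw [Equiv.sum_comp σ fun i => pairDir r (S i)]
  measurable_err := by
    rintro ℓ ⟨ω, rfl⟩ m
    have hℓ := measurableSet_halfSpace ω
    exact (measurable_err_halfSpace hℓ).comp
      (Finset.measurable_sum _ fun i _ => measurable_pairDir_attachLabels r hℓ i)

/-- The pairs of points at distance at most `r`. -/
def closePairs (k : ℕ) (r : ℝ) : Set (HalfBall k × HalfBall k) := {z | dist z.1 z.2 ≤ r}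

theorem measurableSet_closePairs (k : ℕ) (r : ℝ) : MeasurableSet (closePairs k r) :=
  (isClosed_le (by fun_prop) continuous_const).measurableSet

theorem relDev_eq_ofReal {u : EuclideanSpace ℝ (Fin k)} {z : HalfBall k × HalfBall k}
    (hz : inner ℝ u (z.1 : EuclideanSpace ℝ (Fin k)) ≠ 0) :
    relDev u z = ENNReal.ofReal (‖(z.2 : EuclideanSpace ℝ (Fin k)) - foot u z.1‖ /
      |inner ℝ u (z.1 : EuclideanSpace ℝ (Fin k))|) := by
  rw [relDev, ENNReal.ofReal_div_of_pos (abs_pos.2 hz), ofReal_norm, ← Real.norm_eq_abs,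
    ofReal_norm]

/-- Up to the common factor `1 / dist x y`, the component along `u` is `|a| + |b| ≥ |a|` because the
points lie on opposite sides, and the lateral part is, up to sign, the projection of `y - foot u x`.
The normalization cancels in the tangent. -/
theorem pairDir_spec {u : EuclideanSpace ℝ (Fin k)} (hu : ‖u‖ = 1) {r : ℝ} {x y : HalfBall k}
    (hx : inner ℝ u (x : EuclideanSpace ℝ (Fin k)) ≠ 0) (hy : y ∈ opposite (halfSpace u) x)
    (hr : dist x y ≤ r) {n : EuclideanSpace ℝ (Fin k)}
    (hn : n = pairDir r ((x, x ∈ halfSpace u), (y, y ∈ halfSpace u))) :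
    ‖n‖ = 1 ∧ 0 < inner ℝ n u ∧ ‖n - inner ℝ n u • u‖ / inner ℝ n u ≤
      ‖(y : EuclideanSpace ℝ (Fin k)) - foot u x‖ /
        |inner ℝ u (x : EuclideanSpace ℝ (Fin k))| := by
  classical
  have hprod := inner_mul_inner_nonpos_of_mem_closure (subset_closure hy)
  set a : ℝ := inner ℝ u (x : EuclideanSpace ℝ (Fin k)) with ha
  set b : ℝ := inner ℝ u (y : EuclideanSpace ℝ (Fin k)) with hb
  have ha' : 0 < |a| := abs_pos.2 hx
  have hd : 0 < dist x y := ha'.trans_le (abs_inner_le_dist hu hy)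
  obtain ⟨σ, hσ, hσa, hσ1⟩ : ∃ σ : ℝ, n = (σ * (dist x y)⁻¹) •
      ((x : EuclideanSpace ℝ (Fin k)) - y) ∧ σ * a = |a| ∧ |σ| = 1 := by
    by_cases h : x ∈ halfSpace u
    · exact ⟨1, by rw [hn]; simp [pairDir, hr, h], by
        rw [one_mul, abs_of_nonneg (mem_halfSpace.1 h)], abs_one⟩
    · exact ⟨-1, by rw [hn]; simp [pairDir, hr, h], by
        rw [abs_of_neg (not_le.1 h)]; ring, by simp⟩
  have hσb : σ * b ≤ 0 := by
    have h1 : |a| * (σ * b) ≤ 0 := by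
      rw [← hσa]
      have : σ * a * (σ * b) = |σ| ^ 2 * (a * b) := by rw [sq_abs]; ring
      rw [this, hσ1]; linarith
    by_contra! h
    exact (mul_pos ha' h).not_ge h1
  have hdn : dist x y = ‖(x : EuclideanSpace ℝ (Fin k)) - y‖ := by
    rw [Subtype.dist_eq, dist_eq_norm]
  have hinner : inner ℝ n u = (dist x y)⁻¹ * (|a| - σ * b) := by
    rw [hσ, real_inner_smul_left, real_inner_comm, inner_sub_right, ← ha, ← hb, ← hσa]; ring
  have hpos : 0 < inner ℝ n u := by
    rw [hinner]; exact mul_pos (inv_pos.2 hd) (by linarith)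
  refine ⟨?_, hpos, ?_⟩
  · rw [hσ, norm_smul, norm_mul, Real.norm_eq_abs, hσ1, norm_inv, ← hdn, Real.norm_eq_abs,
      abs_of_pos hd, one_mul, inv_mul_cancel₀ hd.ne']
  · set q := (y : EuclideanSpace ℝ (Fin k)) - foot u x with hq
    have hlat : n - inner ℝ n u • u = (-σ * (dist x y)⁻¹) • foot u q := by
      have huq : inner ℝ u q = b := by rw [hq, inner_sub_right, inner_foot hu, sub_zero]
      rw [hinner, ← hσa, foot, huq, hq, foot, ← ha, hσ]
      module
    have hle : ‖n - inner ℝ n u • u‖ ≤ (dist x y)⁻¹ * ‖q‖ := by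
      rw [hlat, norm_smul, norm_mul, norm_neg, Real.norm_eq_abs σ, hσ1, one_mul, norm_inv,
        Real.norm_eq_abs, abs_of_pos hd]
      gcongr
      exact norm_foot_le hu q
    calc ‖n - inner ℝ n u • u‖ / inner ℝ n u
        ≤ ((dist x y)⁻¹ * ‖q‖) / ((dist x y)⁻¹ * |a|) := by
          apply div_le_div₀ (by positivity) hle (by positivity)
          rw [hinner]
          exact mul_le_mul_of_nonneg_left (by linarith) (inv_pos.2 hd).le
      _ = ‖q‖ / |a| := mul_div_mul_left _ _ (inv_pos.2 hd).ne'

/-- The last summand pays for samples without a close pair, where the error is only bounded by `1`.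
Otherwise the tangents of the individual pairs are averaged. -/
theorem err_averagingLearner_le {u : EuclideanSpace ℝ (Fin k)} (hu : ‖u‖ = 1) (r : ℝ) {m : ℕ}
    {S : Fin m → HalfBall k × HalfBall k}
    (hS : ∀ i, inner ℝ u ((S i).1 : EuclideanSpace ℝ (Fin k)) ≠ 0 ∧
      (S i).2 ∈ opposite (halfSpace u) (S i).1) :
    err (uniformBall k) ((averagingLearner k r).hyp m (attachLabels (halfSpace u) S))
        (halfSpace u) ≤
      ENNReal.ofReal (3 / (2 * Real.pi)) * ((∑ i, (closePairs k r).indicator (relDev u) (S i)) *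
        (∑ i, (closePairs k r).indicator 1 (S i))⁻¹) +
      {S : Fin m → HalfBall k × HalfBall k | ∀ i, S i ∉ closePairs k r}.indicator 1 S := by
  classical
  by_cases hnone : ∀ i, S i ∉ closePairs k r
  · refine le_add_left ?_
    rw [Set.indicator_of_mem (by exact hnone)]
    exact prob_le_one
  refine le_add_right ?_
  push Not at hnone
  set I : Finset (Fin m) := {i | S i ∈ closePairs k r} with hI
  have hIne : I.Nonempty := by
    obtain ⟨i, hi⟩ := hnone
    exact ⟨i, by simp [hI, hi]⟩
  have hmem : ∀ i ∈ I, dist (S i).1 (S i).2 ≤ r := fun i hi => (Finset.mem_filter.1 hi).2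
  set n : Fin m → EuclideanSpace ℝ (Fin k) := fun i =>
    pairDir r (attachLabels (halfSpace u) S i) with hn
  set t : Fin m → ℝ := fun i => ‖((S i).2 : EuclideanSpace ℝ (Fin k)) - foot u (S i).1‖ /
    |inner ℝ u ((S i).1 : EuclideanSpace ℝ (Fin k))| with ht
  have hspec := fun i (hi : i ∈ I) =>
    pairDir_spec hu (hS i).1 (hS i).2 (hmem i hi) (n := n i) rfl
  have hsum : ∑ i, n i = ∑ i ∈ I, n i := by
    symm
    apply Finset.sum_subset (Finset.subset_univ _)
    intro i _ hi
    have : ¬ dist (S i).1 (S i).2 ≤ r := fun h => hi (Finset.mem_filter.2 ⟨Finset.mem_univ _, h⟩)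
    simp [hn, pairDir, attachLabels, this]
  obtain ⟨hpos, hle⟩ := norm_sub_inner_smul_div_le hu hIne n t (fun i hi => (hspec i hi).1)
    (fun i hi => (hspec i hi).2.1) (fun i hi => (hspec i hi).2.2)
  have hcard : ∑ i, (closePairs k r).indicator (1 : HalfBall k × HalfBall k → ℝ≥0∞) (S i) =
      (I.card : ℝ≥0∞) := by
    simp [hI, Set.indicator_apply]
  have hdev : ∑ i, (closePairs k r).indicator (relDev u) (S i) =
      ENNReal.ofReal (∑ i ∈ I, t i) := by
    rw [ENNReal.ofReal_sum_of_nonneg (fun i _ => by positivity), hI, Finset.sum_filter]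
    refine Finset.sum_congr rfl fun i _ => ?_
    rw [Set.indicator_apply, relDev_eq_ofReal (hS i).1]
  have hc0 : (0 : ℝ) < I.card := by exact_mod_cast hIne.card_pos
  rw [hcard, hdev, ← div_eq_mul_inv, ← ENNReal.ofReal_natCast,
    ← ENNReal.ofReal_div_of_pos hc0, ← ENNReal.ofReal_mul (by positivity)]
  change err (uniformBall k) (halfSpace (∑ i, n i)) (halfSpace u) ≤ _
  rw [hsum]
  refine (err_halfSpace_le hu hpos).trans (ENNReal.ofReal_le_ofReal ?_)
  gcongr

end Learner

/-! ### Expectations over the contrastive mechanism. -/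

section Mechanism

variable {k : ℕ} {f : ℝ≥0 → ℝ≥0} {u : EuclideanSpace ℝ (Fin k)}
  {D : Kernel (HalfBall k) (HalfBall k)}

theorem measurableSet_good (u : EuclideanSpace ℝ (Fin k)) :
    MeasurableSet {z : HalfBall k × HalfBall k |
      inner ℝ u (z.1 : EuclideanSpace ℝ (Fin k)) ≠ 0 ∧ z.2 ∈ opposite (halfSpace u) z.1} := by
  have h1 : MeasurableSet {z : HalfBall k × HalfBall k |
      inner ℝ u (z.1 : EuclideanSpace ℝ (Fin k)) = 0} :=
    (isClosed_eq (by fun_prop) continuous_const).measurableSet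
  have hu := measurableSet_halfSpace u
  exact h1.compl.inter ((measurable_snd hu).iff (measurable_fst hu)).compl

theorem IsProbAMDM.ae_good (hu : ‖u‖ = 1) (hD : IsProbAMDM f (halfSpace u) D) :
    ∀ᵐ z ∂((uniformBall k).compProd D), inner ℝ u (z.1 : EuclideanSpace ℝ (Fin k)) ≠ 0 ∧
      z.2 ∈ opposite (halfSpace u) z.1 := by
  have := hD.markov
  rw [Measure.ae_compProd_iff (measurableSet_good u)]
  filter_upwards [uniformBall_ae_inner_ne_zero hu] with x hx
  filter_upwards [hD.label_ne x] with y hy using ⟨hx, hy⟩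

/-- Outside the slab no pair is close. Inside it, dropping the closeness restriction leaves a
conditional mean of at most `f |a| / |a|`, which monotonicity bounds by its value at `r`. -/
theorem IsProbAMDM.setLIntegral_relDev_le (hu : ‖u‖ = 1) (hD : IsProbAMDM f (halfSpace u) D)
    (hmono : Monotone fun x : ℝ≥0 => f x / x) (r : ℝ≥0) :
    ∫⁻ z in closePairs k r, relDev u z ∂((uniformBall k).compProd D) ≤
      (f r / r : ℝ≥0) * uniformBall k (slab u r) := by
  have := hD.markov
  have hB := measurableSet_closePairs k r
  rw [← lintegral_indicator hB,
    Measure.lintegral_compProd ((measurable_relDev u).indicator hB),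
    ← lintegral_indicator_const (measurableSet_slab u r)]
  apply lintegral_mono_ae
  filter_upwards [uniformBall_ae_inner_ne_zero hu] with x hx
  by_cases hxr : x ∈ slab u r
  · rw [Set.indicator_of_mem hxr]
    set a : ℝ := inner ℝ u (x : EuclideanSpace ℝ (Fin k)) with ha
    have ha0 : ‖a‖₊ ≠ 0 := by simpa using hx
    have har : ‖a‖₊ ≤ r := by
      rw [← NNReal.coe_le_coe, coe_nnnorm, Real.norm_eq_abs]; exact hxr
    calc ∫⁻ y, (closePairs k r).indicator (relDev u) (x, y) ∂(D x)
        ≤ ∫⁻ y, ‖(y : EuclideanSpace ℝ (Fin k)) - foot u x‖ₑ * ‖a‖ₑ⁻¹ ∂(D x) :=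
          lintegral_mono fun y => Set.indicator_le_self _ _ _
      _ = (∫⁻ y, ‖(y : EuclideanSpace ℝ (Fin k)) - foot u x‖ₑ ∂(D x)) * ‖a‖ₑ⁻¹ :=
          lintegral_mul_const _ (by fun_prop)
      _ ≤ f ‖a‖₊ * ‖a‖ₑ⁻¹ := by
          gcongr
          exact hD.lintegral_enorm_sub_foot_le hu hx
      _ = (f ‖a‖₊ / ‖a‖₊ : ℝ≥0) := by
          rw [enorm_eq_nnnorm, ← div_eq_mul_inv, ENNReal.coe_div ha0]
      _ ≤ (f r / r : ℝ≥0) := by exact_mod_cast hmono har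
  · rw [Set.indicator_of_notMem hxr, nonpos_iff_eq_zero]
    apply lintegral_eq_zero_of_ae_eq_zero
    filter_upwards [hD.label_ne x] with y hy
    apply Set.indicator_of_notMem
    intro h
    exact hxr ((abs_inner_le_dist hu hy).trans h)

/-- If `|a| ≤ 7r/8`, a pair can fail to be close only when `x'` is at least `r/8` from the foot. By
Markov's inequality this has probability at most `1/16`, since `f |a| ≤ a² ≤ r² ≤ r/128`. The
constant is `105/128 = (15/16)(7/8)`, the second factor being the loss from shrinking the slab. -/
theorem IsProbAMDM.le_compProd_closePairs (hu : ‖u‖ = 1) (hD : IsProbAMDM f (halfSpace u) D)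
    (hf : ∀ x, f x ≤ x ^ 2) {r : ℝ≥0} (hr0 : 0 < r) (hr : (r : ℝ) ≤ 1 / 128) :
    ENNReal.ofReal (105 / 128) * uniformBall k (slab u r) ≤
      (uniformBall k).compProd D (closePairs k r) := by
  have := hD.markov
  have hr0' : (0 : ℝ) < r := hr0
  have hB := measurableSet_closePairs k r
  have hslab := mul_uniformBall_slab_le hu (s := 7 / 8) (by norm_num) (by norm_num) r
  calc ENNReal.ofReal (105 / 128) * uniformBall k (slab u r)
      = ENNReal.ofReal (15 / 16) * (ENNReal.ofReal (7 / 8) * uniformBall k (slab u r)) := by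
        rw [← mul_assoc, ← ENNReal.ofReal_mul (by norm_num)]; norm_num
    _ ≤ ENNReal.ofReal (15 / 16) * uniformBall k (slab u (7 / 8 * r)) := by gcongr
    _ = ∫⁻ x, (slab u (7 / 8 * r)).indicator (fun _ => ENNReal.ofReal (15 / 16)) x
          ∂(uniformBall k) := (lintegral_indicator_const (measurableSet_slab u _) _).symm
    _ ≤ ∫⁻ x, D x (Prod.mk x ⁻¹' closePairs k r) ∂(uniformBall k) := ?_
    _ = _ := (Measure.compProd_apply hB).symm
  apply lintegral_mono_ae
  filter_upwards [uniformBall_ae_inner_ne_zero hu] with x hx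
  by_cases hxr : x ∈ slab u (7 / 8 * r)
  swap
  · rw [Set.indicator_of_notMem hxr]; exact zero_le
  rw [Set.indicator_of_mem hxr]
  set a : ℝ := inner ℝ u (x : EuclideanSpace ℝ (Fin k)) with ha
  have har : |a| ≤ 7 / 8 * r := hxr
  have hmeas : MeasurableSet (Prod.mk x ⁻¹' closePairs k r) := measurable_prodMk_left hB
  have hfar : (Prod.mk x ⁻¹' closePairs k r)ᶜ ⊆
      {y : HalfBall k | ENNReal.ofReal (r / 8) ≤
        ‖(y : EuclideanSpace ℝ (Fin k)) - foot u x‖ₑ} := by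
    intro y hy
    have hy' : (r : ℝ) < dist x y := not_le.1 hy
    rw [Subtype.dist_eq, dist_eq_norm] at hy'
    rw [Set.mem_ofPred_eq, ← ofReal_norm]
    apply ENNReal.ofReal_le_ofReal
    have h1 : (x : EuclideanSpace ℝ (Fin k)) - y = a • u - ((y : EuclideanSpace ℝ (Fin k)) -
        foot u x) := by
      rw [foot]; abel
    have h2 := norm_sub_le (a • u) ((y : EuclideanSpace ℝ (Fin k)) - foot u x)
    rw [← h1, norm_smul, hu, mul_one, Real.norm_eq_abs] at h2
    linarith
  have hbad : D x (Prod.mk x ⁻¹' closePairs k r)ᶜ ≤ ENNReal.ofReal (1 / 16) := by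
    refine (measure_mono hfar).trans ?_
    refine (meas_ge_le_lintegral_div (by fun_prop) (by simpa using hr0)
      ENNReal.ofReal_ne_top).trans ?_
    rw [ENNReal.div_le_iff (by simpa using hr0) ENNReal.ofReal_ne_top]
    refine (hD.lintegral_enorm_sub_foot_le hu hx).trans ?_
    rw [← ENNReal.ofReal_coe_nnreal, ← ENNReal.ofReal_mul (by norm_num)]
    apply ENNReal.ofReal_le_ofReal
    have h1 : ((f ‖a‖₊ : ℝ≥0) : ℝ) ≤ |a| ^ 2 := by
      have : ((f ‖a‖₊ : ℝ≥0) : ℝ) ≤ (‖a‖₊ ^ 2 : ℝ≥0) := NNReal.coe_le_coe.2 (hf _)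
      simpa using this
    refine h1.trans ?_
    nlinarith [abs_nonneg a]
  have hsum := prob_add_prob_compl (μ := D x) hmeas
  have h15 : ENNReal.ofReal (15 / 16) = 1 - ENNReal.ofReal (1 / 16) := by
    rw [← ENNReal.ofReal_one, ← ENNReal.ofReal_sub _ (by norm_num)]; norm_num
  rw [h15, tsub_le_iff_right, ← hsum]
  gcongr

/-- The slab measure cancels between the bound on the integrated deviation and the bound on the
probability of closeness. The constant is `3/(2π) · 128/105 = 64/(35π)`. -/
theorem expectedErr_averagingLearner_le (hu : ‖u‖ = 1) (hD : IsProbAMDM f (halfSpace u) D)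
    (hf : ∀ x, f x ≤ x ^ 2) (hmono : Monotone fun x : ℝ≥0 => f x / x) {r : ℝ≥0} (hr0 : 0 < r)
    (hr : (r : ℝ) ≤ 1 / 128) (m : ℕ) :
    expectedErr (averagingLearner k r) (halfSpace u) D m ≤
      ENNReal.ofReal (64 / 35 / Real.pi * (f r / r : ℝ≥0) + Real.exp (-(r * m))) := by
  have := hD.markov
  set ν := (uniformBall k).compProd D
  set B := closePairs k r
  have hB : MeasurableSet B := measurableSet_closePairs k r
  have hgood : ∀ᵐ S ∂(sampleLaw (uniformBall k) D m), ∀ i,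
      inner ℝ u ((S i).1 : EuclideanSpace ℝ (Fin k)) ≠ 0 ∧
        (S i).2 ∈ opposite (halfSpace u) (S i).1 := by
    rw [ae_all_iff]
    intro i
    exact (Measure.quasiMeasurePreserving_eval (fun _ : Fin m => ν) i).ae (hD.ae_good hu)
  have hslab : ENNReal.ofReal (2 * r) ≤ uniformBall k (slab u r) :=
    two_mul_le_uniformBall_slab hu r.2 (by linarith)
  have hr0' : (0 : ℝ) < r := hr0
  have hq := hD.le_compProd_closePairs hu hf hr0 hr
  have hqr : ENNReal.ofReal r ≤ ν B := by
    refine le_trans ?_ hq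
    calc ENNReal.ofReal r ≤ ENNReal.ofReal (105 / 128 * (2 * r)) :=
          ENNReal.ofReal_le_ofReal (by linarith)
      _ = ENNReal.ofReal (105 / 128) * ENNReal.ofReal (2 * r) :=
          ENNReal.ofReal_mul (by norm_num)
      _ ≤ _ := by gcongr
  have hB0 : ν B ≠ 0 := (lt_of_lt_of_le (by simpa using hr0) hqr).ne'
  have hmiss : MeasurableSet {S : Fin m → HalfBall k × HalfBall k | ∀ i, S i ∉ B} := by
    have : {S : Fin m → HalfBall k × HalfBall k | ∀ i, S i ∉ B} =
        ⋂ i, (fun S => S i) ⁻¹' Bᶜ := by ext; simp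
    rw [this]
    exact MeasurableSet.iInter fun i => measurable_pi_apply i hB.compl
  have hratio : (∫⁻ z in B, relDev u z ∂ν) / ν B ≤
      ENNReal.ofReal (128 / 105 * (f r / r : ℝ≥0)) := by
    rw [ENNReal.div_le_iff hB0 (measure_ne_top _ _)]
    refine (hD.setLIntegral_relDev_le hu hmono r).trans ?_
    calc ((f r / r : ℝ≥0) : ℝ≥0∞) * uniformBall k (slab u r)
        = ENNReal.ofReal (128 / 105 * (f r / r : ℝ≥0)) *
          (ENNReal.ofReal (105 / 128) * uniformBall k (slab u r)) := by
          rw [← mul_assoc, ← ENNReal.ofReal_mul (by positivity), ← ENNReal.ofReal_coe_nnreal]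
          congr 2; ring
      _ ≤ _ := by gcongr
  have hmain : ∫⁻ S, (∑ i, B.indicator (relDev u) (S i)) * (∑ i, B.indicator 1 (S i))⁻¹
      ∂(sampleLaw (uniformBall k) D m) ≤ (∫⁻ z in B, relDev u z ∂ν) / ν B :=
    lintegral_average_le ν m hB hB0 (measurable_relDev u)
  have hnone : sampleLaw (uniformBall k) D m {S | ∀ i, S i ∉ B} ≤
      ENNReal.ofReal (Real.exp (-(r * m))) := by
    have h := measure_pi_forall_notMem ν m hB
    rw [sampleLaw, h]
    calc (1 - ν B) ^ m ≤ (1 - ENNReal.ofReal r) ^ m := by gcongr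
      _ = ENNReal.ofReal ((1 - r) ^ m) := by
          rw [← ENNReal.ofReal_one, ← ENNReal.ofReal_sub _ hr0'.le,
            ENNReal.ofReal_pow (by linarith)]
      _ ≤ ENNReal.ofReal (Real.exp (-(r * m))) := by
          apply ENNReal.ofReal_le_ofReal
          have h1 : (1 : ℝ) - r ≤ Real.exp (-r) := Real.one_sub_le_exp_neg r
          calc (1 - (r : ℝ)) ^ m ≤ Real.exp (-r) ^ m :=
                pow_le_pow_left₀ (by linarith) h1 m
            _ = Real.exp (-(r * m)) := by rw [← Real.exp_nat_mul]; congr 1; ring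
  calc expectedErr (averagingLearner k r) (halfSpace u) D m
      ≤ ∫⁻ S, (ENNReal.ofReal (3 / (2 * Real.pi)) * ((∑ i, B.indicator (relDev u) (S i)) *
          (∑ i, B.indicator 1 (S i))⁻¹) +
          {S : Fin m → HalfBall k × HalfBall k | ∀ i, S i ∉ B}.indicator 1 S)
          ∂(sampleLaw (uniformBall k) D m) := by
        apply lintegral_mono_ae
        filter_upwards [hgood] with S hS using err_averagingLearner_le hu r hS
    _ = ENNReal.ofReal (3 / (2 * Real.pi)) *
          ∫⁻ S, (∑ i, B.indicator (relDev u) (S i)) * (∑ i, B.indicator 1 (S i))⁻¹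
            ∂(sampleLaw (uniformBall k) D m) +
          sampleLaw (uniformBall k) D m {S | ∀ i, S i ∉ B} := by
        rw [lintegral_add_right _ (measurable_one.indicator hmiss),
          lintegral_const_mul' _ _ ENNReal.ofReal_ne_top, lintegral_indicator_one hmiss]
    _ ≤ ENNReal.ofReal (3 / (2 * Real.pi)) * ENNReal.ofReal (128 / 105 * (f r / r : ℝ≥0)) +
          ENNReal.ofReal (Real.exp (-(r * m))) := by
        gcongr
        exact hmain.trans hratio
    _ = ENNReal.ofReal (64 / 35 / Real.pi * (f r / r : ℝ≥0) + Real.exp (-(r * m))) := by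
        rw [← ENNReal.ofReal_mul (by positivity), ← ENNReal.ofReal_add (by positivity)
          (by positivity)]
        congr 2
        field_simp
        ring

/-- The zero normal labels every point positively, leaving nowhere for a contrastive distribution to
live; so an admissible family excludes it. -/
theorem exists_unit_normal {ℓ : Set (HalfBall k)} (hℓ : ℓ ∈ homHalfSpaces k)
    (hD : IsProbAMDM f ℓ D) : ∃ u : EuclideanSpace ℝ (Fin k), ‖u‖ = 1 ∧ ℓ = halfSpace u := by
  obtain ⟨ω, rfl⟩ := hℓ
  have := hD.markov
  have hω : ω ≠ 0 := by
    rintro rfl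
    let x : HalfBall k := ⟨0, by simp⟩
    have h := hD.label_ne x
    simp [opposite] at h
    exact IsProbabilityMeasure.ne_zero (D x) h
  have hpos : 0 < ‖ω‖⁻¹ := inv_pos.2 (norm_pos_iff.2 hω)
  refine ⟨‖ω‖⁻¹ • ω, norm_smul_inv_norm hω, ?_⟩
  ext x
  rw [mem_halfSpace, real_inner_smul_left, mul_nonneg_iff_of_pos_left hpos]
  rfl

end Mechanism

end Contrastive

/-! ### Choice of constants and the sample complexity bound. -/

theorem theorem11 :
    ∃ K : ℝ, 0 < K ∧
      ∀ f : ℝ≥0 → ℝ≥0, (∀ x, f x ≤ x ^ 2) →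
        Monotone (fun x : ℝ≥0 => f x / x) → Function.Injective (fun x : ℝ≥0 => f x / x) →
        ∃ ε₀ : ℝ, 0 < ε₀ ∧ ε₀ ≤ 1 ∧
          ∀ (k : ℕ) (ε : ℝ), 0 < ε → ε < ε₀ →
            ∀ r : ℝ≥0, ((f r / r : ℝ≥0) : ℝ) = Real.pi * ε / 2 →
              ∃ n : ℕ,
                Contrastive.passiveComplexity (Contrastive.uniformBall k)
                  (Contrastive.homHalfSpaces k) f ε = (n : ℕ∞) ∧
                (n : ℝ) ≤ K * (Real.log (1 / ε) / (r : ℝ)) := by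
  -- `2 L / r` pairs suffice with `L = log(1/ε)`, and rounding up costs at most one more `L / r`, as
  -- `L / r ≥ 1`.
  refine ⟨3, by norm_num, fun f hf hmono hinj => ?_⟩
  set g : ℝ≥0 → ℝ≥0 := fun x => f x / x with hg
  have hg0 : 0 < g (1 / 128) := by
    -- Division by zero gives the convention `g 0 = 0`; injectivity then makes `g` positive at
    -- `1/128`.
    have h0 : g 0 = 0 := by simp [hg]
    refine lt_of_le_of_ne zero_le fun h => ?_
    have := hinj (h0.trans h)
    norm_num at this
  have hg0' : (0 : ℝ) < g (1 / 128) := hg0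
  -- `1/12 < 3/35` lets `ε²` fit into the slack `ε - (32/35) ε`, and also gives `log(1/ε) ≥ 1`. The
  -- second bound yields `πε/2 < 2ε < g(1/128)`, which forces `r ≤ 1/128` by monotonicity.
  refine ⟨min (1 / 12) (g (1 / 128) / 2), by positivity,
    (min_le_left _ _).trans (by norm_num), fun k ε hε hε0 r hr => ?_⟩
  have hε1 : ε < 1 / 12 := hε0.trans_le (min_le_left _ _)
  have hε2 : ε < g (1 / 128) / 2 := hε0.trans_le (min_le_right _ _)
  have hpi := Real.pi_pos
  have hrpos : 0 < r := by
    refine pos_iff_ne_zero.2 fun h => ?_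
    rw [h] at hr
    have : 0 < Real.pi * ε / 2 := by positivity
    simp [← hr] at this
  have hrpos' : (0 : ℝ) < r := hrpos
  have hrle : (r : ℝ) ≤ 1 / 128 := by
    by_contra! h
    have h' : (1 / 128 : ℝ≥0) ≤ r := by
      rw [← NNReal.coe_le_coe]; simpa using h.le
    have : ((g (1 / 128) : ℝ≥0) : ℝ) ≤ (f r / r : ℝ≥0) := NNReal.coe_le_coe.2 (hmono h')
    rw [hr] at this
    nlinarith [Real.pi_lt_four]
  set L := Real.log (1 / ε) with hL
  have hLε : Real.exp (-L) = ε := by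
    rw [hL, one_div, Real.log_inv, neg_neg, Real.exp_log hε]
  have hL1 : 1 ≤ L := by
    rw [hL, Real.le_log_iff_exp_le (by positivity), le_div_iff₀ hε]
    nlinarith [Real.exp_one_lt_d9, Real.exp_pos 1]
  set M := ⌈2 * (L / r)⌉₊ with hM
  have hcomplexity : Contrastive.passiveComplexity (Contrastive.uniformBall k)
      (Contrastive.homHalfSpaces k) f ε ≤ (M : ℕ∞) := by
    refine (iInf_le _ (Contrastive.averagingLearner k r)).trans ?_
    refine iInf₂_le M fun ℓ hℓ m hm D hD => ?_
    obtain ⟨u, hu, rfl⟩ := Contrastive.exists_unit_normal hℓ hD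
    refine (Contrastive.expectedErr_averagingLearner_le hu hD hf hmono hrpos hrle m).trans
      (ENNReal.ofReal_le_ofReal ?_)
    rw [hr]
    have h1 : 64 / 35 / Real.pi * (Real.pi * ε / 2) = 32 / 35 * ε := by
      field_simp; norm_num
    have h2 : Real.exp (-(r * m)) ≤ ε * ε := by
      have h3 : 2 * (L / r) ≤ m := (Nat.le_ceil _).trans (by exact_mod_cast hm)
      have h4 : L + L ≤ r * m := by
        calc L + L = r * (2 * (L / r)) := by field_simp; ring
          _ ≤ r * m := mul_le_mul_of_nonneg_left h3 hrpos'.le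
      rw [← hLε, ← Real.exp_add]
      exact Real.exp_le_exp.2 (by linarith)
    rw [h1]
    nlinarith
  obtain ⟨n, hn⟩ := ENat.ne_top_iff_exists.1 (ne_top_of_le_ne_top (ENat.natCast_ne_top M) hcomplexity)
  refine ⟨n, hn.symm, ?_⟩
  have hnM : n ≤ M := by
    rw [← hn] at hcomplexity; exact_mod_cast hcomplexity
  have hLr : 1 ≤ L / r := by
    rw [le_div_iff₀ hrpos']; linarith
  calc (n : ℝ) ≤ M := by exact_mod_cast hnM
    _ ≤ 2 * (L / r) + 1 := (Nat.ceil_lt_add_one (by positivity)).le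
    _ ≤ 3 * (L / r) := by linarith
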